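/- All manifolds, maps, tensor fields, sections and distributions are smooth ($C^\infty$). A *globally framed $f$-structure* (g.f.f-structure) on a manifold is a triple $(\varphi,\xi_\alpha,\eta^\alpha)_{1\le\alpha\le r}$ consisting of a $(1,1)$-tensor field $\varphi$ of constant non-zero rank, vector fields $\xi_\alpha$ that form a basis of $\ker\varphi$ at every point, and $1$-forms $\eta^\alpha$ such that $\varphi^2=-I+\sum_\alpha\eta^\alpha\otimes\xi_\alpha$ and $\eta^\alpha(\xi_\beta)=\delta^\alpha_\beta$. An *indefinite $\mathcal S$-manifold* $(\bar M,\bar\varphi,\bar\xi_\alpha,\bar\eta^\alpha,\bar g)$ is a manifold with a g.f.f-structure and a semi-Riemannian metric $\bar g$ of index $\nu$, $0<\nu<\dim\bar M$, such that each $\bar\xi_\alpha$ is spacelike ($\varepsilon_\alpha=1$) or timelike ($\varepsilon_\alpha=-1$), $$\bar g(\bar\varphi X,\bar\varphi Y)=\bar g(X,Y)-\sum_\alpha\varepsilon_\alpha\bar\eta^\alpha(X)\bar\eta^\alpha(Y),$$ $d\bar\eta^\alpha=\Phi$ for every $\alpha$, where $\Phi(X,Y)=\bar g(X,\bar\varphi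 Y)$, and $N_{\bar\varphi}+2\sum_\alpha d\bar\eta^\alpha\otimes\bar\xi_\alpha=0$. Here $N_{\bar\varphi}$ is the Nijenhuis torsion, $N_{\bar\varphi}(X,Y)=[\bar\varphi X,\bar\varphi Y]+\bar\varphi^2[X,Y]-\bar\varphi[\bar\varphi X,Y]-\bar\varphi[X,\bar\varphi Y]$, and $d\eta(X,Y)=\tfrac12\big(X(\eta(Y))-Y(\eta(X))-\eta([X,Y])\big)$. Let $M$ be an (immersed) hypersurface of an indefinite $\mathcal S$-manifold $\bar M$ which is *lightlike*, that is, the induced metric $g$ is degenerate at every point, so that $\mathrm{Rad}(T_pM)=T_pM\cap T_pM^\perp\neq 0$ for all $p\in M$, and *characteristic*, that is, all $\bar\xi_\alpha$ are tangent to $M$. Let $E$ be a global nowhere zero section of $\mathrm{Rad}(TM)$. Let $S(TM)$ be a characteristic screen distribution: a distribution on $M$ with $TM=\mathrm{Rad}(TM)\oplus S(TM)$, $\ker\bar\varphi|_M\subset S(TM)$ and $\bar\varphi E\in\Gamma(S(TM))$. Let $N$ be the associated transversal section, globally defined on $M$: the section of $T\bar M|_M$ with $\bar g(N,E)=1$,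 $\bar g(N,N)=0$ and $\bar g(N,W)=0$ for all $W\in\Gamma(S(TM))$. Let $\mathrm{ltr}(M)$ be the line bundle spanned by $N$. Let $D_0$ be the $g$-orthogonal complement of $\bar\varphi(\mathrm{Rad}(TM))\oplus\bar\varphi(\mathrm{ltr}(M))$ in $S(TM)$ and let $D=D_0\oplus\bar\varphi(\mathrm{Rad}(TM))\oplus\mathrm{Rad}(TM)$. **Theorem.** The vector fields $U=-\bar\varphi N$ and $V=-\bar\varphi E$ are tangent to $M$, and $TM=D\oplus\bar\varphi(\mathrm{ltr}(M))$. Let $S:TM\to D$ be the projection along $\bar\varphi(\mathrm{ltr}(M))$. Then $\varphi X:=\bar\varphi(SX)$ is tangent to $M$ for every $X$ tangent to $M$, and, with $\eta^\alpha=\bar\eta^\alpha|_{TM}$ and $u(X)=g(X,V)$, the tensors $(\varphi;\ \bar\xi_1,\dots,\bar\xi_r,U;\ \eta^1,\dots,\eta^r,u)$ form a globally framed $f$-structure on $M$. -/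

import Mathlib

open Bundle Module
open scoped Manifold ContDiff

noncomputable section

namespace LightlikeGFF

/-! ### Tensor fields on a manifold of dimension `m`

Manifolds of dimension `m` are charted spaces over `EuclideanSpace ℝ (Fin m)`, without boundary. -/

section Tensors

variable {m : ℕ} {M : Type*} [TopologicalSpace M] [ChartedSpace (EuclideanSpace ℝ (Fin m)) M]
  [IsManifold (𝓡 m) ∞ M]

/-- Smoothness at a point of a vector field. -/
def SmoothFieldAt (X : Π p : M, TangentSpace (𝓡 m) p) (p : M) : Prop :=
  ContMDiffAt (𝓡 m) (𝓡 m).tangent ∞ (fun q => (⟨q, X q⟩ : TangentBundle (𝓡 m) M)) p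

/-- Smooth vector fields. -/
def SmoothField (X : Π p : M, TangentSpace (𝓡 m) p) : Prop :=
  ∀ p, SmoothFieldAt X p

/-- Smooth 1-forms, as smooth sections of the cotangent bundle. -/
def SmoothForm (η : Π p : M, TangentSpace (𝓡 m) p →L[ℝ] ℝ) : Prop :=
  ContMDiff (𝓡 m) ((𝓡 m).prod 𝓘(ℝ, EuclideanSpace ℝ (Fin m) →L[ℝ] ℝ)) ∞
    (fun p => TotalSpace.mk' (EuclideanSpace ℝ (Fin m) →L[ℝ] ℝ)
      (E := fun p : M => TangentSpace (𝓡 m) p →L[ℝ] ℝ) p (η p))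

/-- Smooth tensor fields of type (1,1), as smooth sections of `Hom(TM, TM)`. -/
def SmoothEndo (φ : Π p : M, TangentSpace (𝓡 m) p →L[ℝ] TangentSpace (𝓡 m) p) : Prop :=
  ContMDiff (𝓡 m)
    ((𝓡 m).prod 𝓘(ℝ, EuclideanSpace ℝ (Fin m) →L[ℝ] EuclideanSpace ℝ (Fin m))) ∞
    (fun p => TotalSpace.mk' (EuclideanSpace ℝ (Fin m) →L[ℝ] EuclideanSpace ℝ (Fin m))
      (E := fun p : M => TangentSpace (𝓡 m) p →L[ℝ] TangentSpace (𝓡 m) p) p (φ p))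

/-- Smooth tensor fields of type (0,2), as smooth sections of `Hom(TM, T*M)`. -/
def SmoothBilin (g : Π p : M, TangentSpace (𝓡 m) p →L[ℝ] TangentSpace (𝓡 m) p →L[ℝ] ℝ) : Prop :=
  ContMDiff (𝓡 m)
    ((𝓡 m).prod 𝓘(ℝ, EuclideanSpace ℝ (Fin m) →L[ℝ] EuclideanSpace ℝ (Fin m) →L[ℝ] ℝ)) ∞
    (fun p => TotalSpace.mk' (EuclideanSpace ℝ (Fin m) →L[ℝ] EuclideanSpace ℝ (Fin m) →L[ℝ] ℝ)
      (E := fun p : M => TangentSpace (𝓡 m) p →L[ℝ] TangentSpace (𝓡 m) p →L[ℝ] ℝ) p (g p))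

/-- A semi-Riemannian metric of index `ν`: a smooth field of nondegenerate symmetric bilinear
forms, each of which has `ν` as the maximal dimension of a negative definite subspace. -/
structure IsSemiRiemannianMetric
    (g : Π p : M, TangentSpace (𝓡 m) p →L[ℝ] TangentSpace (𝓡 m) p →L[ℝ] ℝ) (ν : ℕ) : Prop where
  smooth : SmoothBilin g
  symm : ∀ p v w, g p v w = g p w v
  nondegenerate : ∀ p v, (∀ w, g p v w = 0) → v = 0
  index : ∀ p, IsGreatest
    {k | ∃ W : Submodule ℝ (TangentSpace (𝓡 m) p), finrank ℝ W = k ∧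
      ∀ w ∈ W, w ≠ 0 → g p w w < 0} ν

/-- A globally framed `f`-structure `(φ, ξ_α, η^α)`, `α = 1, …, r`: a (1,1)-tensor field `φ` of
constant nonzero rank whose kernel is parallelized by the vector fields `ξ_α`, with dual 1-forms
`η^α`, such that `φ² = -I + ∑ η^α ⊗ ξ_α` and `η^α(ξ_β) = δ^α_β`. -/
structure IsGloballyFramed {r : ℕ}
    (φ : Π p : M, TangentSpace (𝓡 m) p →L[ℝ] TangentSpace (𝓡 m) p)
    (ξ : Fin r → Π p : M, TangentSpace (𝓡 m) p)
    (η : Fin r → Π p : M, TangentSpace (𝓡 m) p →L[ℝ] ℝ) : Prop where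
  smooth_phi : SmoothEndo φ
  smooth_xi : ∀ α, SmoothField (ξ α)
  smooth_eta : ∀ α, SmoothForm (η α)
  rank : ∃ k : ℕ, 0 < k ∧ ∀ p, finrank ℝ (φ p).range = k
  ker_eq : ∀ p, (φ p).ker = Submodule.span ℝ (Set.range fun α => ξ α p)
  sq : ∀ p X, φ p (φ p X) = -X + ∑ α, η α p X • ξ α p
  dual : ∀ p α β, η α p (ξ β p) = if α = β then 1 else 0

/-- An indefinite metric globally framed `f`-structure: `g` has index `0 < ν < m`, each `ξ_α` is
everywhere spacelike (`ε_α = 1`) or everywhere timelike (`ε_α = -1`), and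
`g(φX, φY) = g(X, Y) - ∑ ε_α η^α(X) η^α(Y)`. -/
structure IsIndefiniteMetricGFF {r : ℕ}
    (φ : Π p : M, TangentSpace (𝓡 m) p →L[ℝ] TangentSpace (𝓡 m) p)
    (ξ : Fin r → Π p : M, TangentSpace (𝓡 m) p)
    (η : Fin r → Π p : M, TangentSpace (𝓡 m) p →L[ℝ] ℝ)
    (g : Π p : M, TangentSpace (𝓡 m) p →L[ℝ] TangentSpace (𝓡 m) p →L[ℝ] ℝ) : Prop where
  framed : IsGloballyFramed φ ξ η
  metric : ∃ ν, 0 < ν ∧ ν < m ∧ IsSemiRiemannianMetric g ν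
  compatible : ∃ ε : Fin r → ℝ,
    (∀ α, (ε α = 1 ∧ ∀ p, 0 < g p (ξ α p) (ξ α p)) ∨
      (ε α = -1 ∧ ∀ p, g p (ξ α p) (ξ α p) < 0)) ∧
    ∀ p X Y, g p (φ p X) (φ p Y) = g p X Y - ∑ α, ε α * η α p X * η α p Y

/-- The value at `p` of `dη(X, Y) = ½ (X(η(Y)) - Y(η(X)) - η([X, Y]))`. -/
def extD (η : Π p : M, TangentSpace (𝓡 m) p →L[ℝ] ℝ)
    (X Y : Π p : M, TangentSpace (𝓡 m) p) (p : M) : ℝ :=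
  (1 / 2 : ℝ) * (mvfderiv (𝓡 m) (fun q => η q (Y q)) p (X p)
    - mvfderiv (𝓡 m) (fun q => η q (X q)) p (Y p)
    - η p (VectorField.mlieBracket (𝓡 m) X Y p))

/-- The value at `p` of the Nijenhuis torsion
`N_φ(X, Y) = [φX, φY] + φ²[X, Y] - φ[φX, Y] - φ[X, φY]`. -/
def nijenhuis (φ : Π p : M, TangentSpace (𝓡 m) p →L[ℝ] TangentSpace (𝓡 m) p)
    (X Y : Π p : M, TangentSpace (𝓡 m) p) (p : M) : TangentSpace (𝓡 m) p :=
  VectorField.mlieBracket (𝓡 m) (fun q => φ q (X q)) (fun q => φ q (Y q)) p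
    + φ p (φ p (VectorField.mlieBracket (𝓡 m) X Y p))
    - φ p (VectorField.mlieBracket (𝓡 m) (fun q => φ q (X q)) Y p)
    - φ p (VectorField.mlieBracket (𝓡 m) X (fun q => φ q (Y q)) p)

/-- An indefinite `𝒮`-manifold: a normal indefinite metric globally framed `f`-manifold such that
`dη^α = Φ` for every `α`, where `Φ(X, Y) = g(X, φY)`; normality is
`N_φ + 2 ∑ dη^α ⊗ ξ_α = 0`. -/
structure IsIndefiniteSManifold {r : ℕ}
    (φ : Π p : M, TangentSpace (𝓡 m) p →L[ℝ] TangentSpace (𝓡 m) p)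
    (ξ : Fin r → Π p : M, TangentSpace (𝓡 m) p)
    (η : Fin r → Π p : M, TangentSpace (𝓡 m) p →L[ℝ] ℝ)
    (g : Π p : M, TangentSpace (𝓡 m) p →L[ℝ] TangentSpace (𝓡 m) p →L[ℝ] ℝ) : Prop where
  metricGFF : IsIndefiniteMetricGFF φ ξ η g
  normal : ∀ (p : M) (X Y : Π p : M, TangentSpace (𝓡 m) p),
    SmoothFieldAt X p → SmoothFieldAt Y p →
      nijenhuis φ X Y p + (2 : ℝ) • ∑ α, extD (η α) X Y p • ξ α p = 0
  contact : ∀ (α : Fin r) (p : M) (X Y : Π p : M, TangentSpace (𝓡 m) p),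
    SmoothFieldAt X p → SmoothFieldAt Y p → extD (η α) X Y p = g p (X p) (φ p (Y p))

/-- A smooth distribution: a field of subspaces locally spanned by linearly independent smooth
vector fields. -/
def IsSmoothDistribution (S : Π p : M, Submodule ℝ (TangentSpace (𝓡 m) p)) : Prop :=
  ∀ p₀ : M, ∃ (k : ℕ) (X : Fin k → Π p : M, TangentSpace (𝓡 m) p) (O : Set M),
    IsOpen O ∧ p₀ ∈ O ∧ ∀ p ∈ O, (∀ i, SmoothFieldAt (X i) p) ∧
      LinearIndependent ℝ (fun i => X i p) ∧ Submodule.span ℝ (Set.range fun i => X i p) = S p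

end Tensors

/-! ### Lightlike hypersurfaces

The hypersurface is a smooth immersion `ι : M → Mbar` of a `d`-dimensional manifold into a
`(d+1)`-dimensional one. A vector of `T_{ι p} Mbar` is tangent to `M` when it lies in the range of
`dι_p`. -/

section Hypersurface

variable {d : ℕ}
  {Mbar : Type*} [TopologicalSpace Mbar] [ChartedSpace (EuclideanSpace ℝ (Fin (d + 1))) Mbar]
  [IsManifold (𝓡 (d + 1)) ∞ Mbar]
  {M : Type*} [TopologicalSpace M] [ChartedSpace (EuclideanSpace ℝ (Fin d)) M]
  [IsManifold (𝓡 d) ∞ M]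

/-- The differential `dι_p : T_p M → T_{ι p} Mbar`. -/
abbrev dMap (ι : M → Mbar) (p : M) :
    TangentSpace (𝓡 d) p →L[ℝ] TangentSpace (𝓡 (d + 1)) (ι p) :=
  mfderiv (𝓡 d) (𝓡 (d + 1)) ι p

variable (g : Π q : Mbar,
    TangentSpace (𝓡 (d + 1)) q →L[ℝ] TangentSpace (𝓡 (d + 1)) q →L[ℝ] ℝ)
  (φ : Π q : Mbar, TangentSpace (𝓡 (d + 1)) q →L[ℝ] TangentSpace (𝓡 (d + 1)) q)
  (ι : M → Mbar)

/-- The induced (degenerate) metric on `M`. -/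
def inducedMetric (p : M) (v w : TangentSpace (𝓡 d) p) : ℝ :=
  g (ι p) (dMap ι p v) (dMap ι p w)

/-- `Rad(T_p M)`: the vectors of `T_p M` orthogonal to all of `T_p M`. -/
def rad (p : M) : Submodule ℝ (TangentSpace (𝓡 d) p) where
  carrier := {v | ∀ w, inducedMetric g ι p v w = 0}
  add_mem' := by
    intro a b ha hb w
    have h1 := ha w
    have h2 := hb w
    simp only [inducedMetric] at h1 h2 ⊢
    simp [h1, h2]
  zero_mem' := by
    intro w
    simp [inducedMetric]
  smul_mem' := by
    intro c x hx w
    have h1 := hx w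
    simp only [inducedMetric] at h1 ⊢
    simp [h1]

/-- A lightlike hypersurface: a smooth immersion in codimension one whose induced metric is
degenerate at every point. -/
structure IsLightlikeHypersurface : Prop where
  smooth : ContMDiff (𝓡 d) (𝓡 (d + 1)) ∞ ι
  injective : ∀ p : M, Function.Injective (dMap (d := d) ι p)
  degenerate : ∀ p, rad g ι p ≠ ⊥

/-- All the characteristic vector fields `ξ_α` are tangent to `M`. -/
def IsCharacteristic {r : ℕ} (ξ : Fin r → Π q : Mbar, TangentSpace (𝓡 (d + 1)) q) : Prop :=
  ∀ α p, ξ α (ι p) ∈ (dMap ι p).range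

/-- A global nowhere zero smooth section of `Rad(TM)`. -/
structure IsRadicalSection (E : Π p : M, TangentSpace (𝓡 d) p) : Prop where
  smooth : SmoothField E
  mem_rad : ∀ p, E p ∈ rad g ι p
  ne_zero : ∀ p, E p ≠ 0

/-- A characteristic screen distribution: a smooth distribution complementary to `Rad(TM)` in `TM`
that contains `ker φ` and `φE`. -/
structure IsCharacteristicScreen (E : Π p : M, TangentSpace (𝓡 d) p)
    (S : Π p : M, Submodule ℝ (TangentSpace (𝓡 d) p)) : Prop where
  smooth : IsSmoothDistribution S
  isCompl : ∀ p, IsCompl (rad g ι p) (S p)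
  ker_le : ∀ p, (φ (ι p)).ker ≤ (S p).map (dMap ι p).toLinearMap
  phi_mem : ∀ p, φ (ι p) (dMap ι p (E p)) ∈ (S p).map (dMap ι p).toLinearMap

/-- A global smooth section `N` of `T Mbar` along `M` with `g(N, E) = 1`, `g(N, N) = 0` and
`g(N, W) = 0` for all `W` in the screen distribution; it spans the lightlike transversal bundle. -/
structure IsTransversalSection (E : Π p : M, TangentSpace (𝓡 d) p)
    (S : Π p : M, Submodule ℝ (TangentSpace (𝓡 d) p))
    (N : Π p : M, TangentSpace (𝓡 (d + 1)) (ι p)) : Prop where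
  smooth : ContMDiff (𝓡 d) (𝓡 (d + 1)).tangent ∞
    (fun p => (⟨ι p, N p⟩ : TangentBundle (𝓡 (d + 1)) Mbar))
  pair_E : ∀ p, g (ι p) (N p) (dMap ι p (E p)) = 1
  null : ∀ p, g (ι p) (N p) (N p) = 0
  orth : ∀ p, ∀ W ∈ S p, g (ι p) (N p) (dMap ι p W) = 0

/-- `φ(Rad(TM))`, as a field of subspaces of `TM`. -/
def phiRad (p : M) : Submodule ℝ (TangentSpace (𝓡 d) p) :=
  (((rad g ι p).map (dMap ι p).toLinearMap).map (φ (ι p)).toLinearMap).comap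
    (dMap ι p).toLinearMap

/-- `φ(ltr(M))`, as a field of subspaces of `TM`, where `ltr(M)` is spanned by `N`. -/
def phiLtr (N : Π p : M, TangentSpace (𝓡 (d + 1)) (ι p)) (p : M) :
    Submodule ℝ (TangentSpace (𝓡 d) p) :=
  ((Submodule.span ℝ {N p}).map (φ (ι p)).toLinearMap).comap (dMap ι p).toLinearMap

/-- `D₀`: the orthogonal complement of `φ(Rad(TM)) ⊕ φ(ltr(M))` in the screen distribution. -/
def distD₀ (S : Π p : M, Submodule ℝ (TangentSpace (𝓡 d) p))
    (N : Π p : M, TangentSpace (𝓡 (d + 1)) (ι p)) (p : M) :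
    Submodule ℝ (TangentSpace (𝓡 d) p) where
  carrier := {v | v ∈ S p ∧ ∀ w ∈ phiRad g φ ι p ⊔ phiLtr φ ι N p, inducedMetric g ι p v w = 0}
  add_mem' := by
    intro a b ha hb
    refine ⟨(S p).add_mem ha.1 hb.1, fun w hw => ?_⟩
    have h1 := ha.2 w hw
    have h2 := hb.2 w hw
    simp only [inducedMetric] at h1 h2 ⊢
    simp [h1, h2]
  zero_mem' := by
    refine ⟨(S p).zero_mem, fun w _ => ?_⟩
    simp [inducedMetric]
  smul_mem' := by
    intro c x hx
    refine ⟨(S p).smul_mem c hx.1, fun w hw => ?_⟩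
    have h1 := hx.2 w hw
    simp only [inducedMetric] at h1 ⊢
    simp [h1]

/-- `D = D₀ ⊥ φ(Rad(TM)) ⊥ Rad(TM)`. -/
def distD (S : Π p : M, Submodule ℝ (TangentSpace (𝓡 d) p))
    (N : Π p : M, TangentSpace (𝓡 (d + 1)) (ι p)) (p : M) :
    Submodule ℝ (TangentSpace (𝓡 d) p) :=
  distD₀ g φ ι S N p ⊔ phiRad g φ ι p ⊔ rad g ι p

end Hypersurface

end LightlikeGFF

end

/-!
The algebra is pointwise. In a metric globally framed `f`-structure `φbar` is skew-adjoint and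
`ηbar^α` is, up to sign, metrically dual to `ξbar_α`. As the `ξbar_α` lie in the screen, all the
`ηbar^α` vanish on `E` and `N`, and therefore
`g(φbar N, φbar E) = g(N, E) = 1` and `φbar² E = -E`.
The tangent hyperplane of the hypersurface is `E^⊥` (`mem_range_of_g_E`). Since `φbar E` is in the
screen, `g(φbar N, E) = -g(N, φbar E) = 0`, so `U = -φbar N` is tangent; it even lies in the screen,
where `U` and `V = -φbar E` span a hyperbolic plane. Splitting off this plane from the screen
identifies `D` with the kernel of `u = g(·, V)` (`mem_distD_iff`), and `u(U) = 1`; so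
`TM = D ⊕ ℝ U`, with projection `X ↦ X - u(X) U` onto `D`.

Hence `φ X = φbar (X - u(X) U)`. It is orthogonal to `E` by skew-adjointness and `u(U) = 1`, so it
is tangent, and it is orthogonal to `V` because `g(φbar Y, φbar E) = g(Y, E) = 0` for tangent `Y`,
so `u ∘ φ = 0`. It follows that `φ² X = φbar² (X - u(X) U) = -X + ∑ η^α(X) ξ_α + u(X) U`. The kernel
and the constancy of the rank are formal consequences of this identity and the duality relations
(`isGloballyFramed_of_sq_of_dual`), and `φ` is nonzero because `φ V = E`.

Smoothness is tested on vector fields: a tensor field is smooth if it maps smooth fields to smooth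
fields or functions (`smoothEndo_of_forall`, `smoothForm_of_forall`). The vector fields on `M`
that occur are lifts of smooth fields along the immersion, and such lifts are smooth
(`smoothFieldAt_of_dMap`).
-/

namespace LightlikeGFF

/-! ### Smoothness tested on vector fields -/

section ClmCoord

variable {H B F F' : Type*} {EB : Type*} [NormedAddCommGroup EB] [NormedSpace ℝ EB]
  [TopologicalSpace H] {I : ModelWithCorners ℝ EB H} [TopologicalSpace B] [ChartedSpace H B]
  [NormedAddCommGroup F] [NormedSpace ℝ F] [FiniteDimensional ℝ F]
  [NormedAddCommGroup F'] [NormedSpace ℝ F'] {n : WithTop ℕ∞}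

theorem contMDiffAt_clm_of_apply {f : B → F →L[ℝ] F'} {x : B}
    (h : ∀ v, ContMDiffAt I 𝓘(ℝ, F') n (fun y => f y v) x) :
    ContMDiffAt I 𝓘(ℝ, F →L[ℝ] F') n f x := by
  have hd : finrank ℝ F = finrank ℝ (Fin (finrank ℝ F) → ℝ) := (finrank_fin_fun ℝ).symm
  let e₁ := ContinuousLinearEquiv.ofFinrankEq hd
  let e₂ := (e₁.arrowCongr (1 : F' ≃L[ℝ] F')).trans (ContinuousLinearEquiv.piRing _)
  have h₂ : ContMDiffAt I 𝓘(ℝ, Fin (finrank ℝ F) → F') n (fun y => e₂ (f y)) x :=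
    contMDiffAt_pi_space.2 fun i => h _
  have h₃ := (e₂.symm.contDiff (n := n)).contMDiff.contMDiffAt.comp x h₂
  refine h₃.congr_of_eventuallyEq (Filter.Eventually.of_forall fun y => ?_)
  simp

end ClmCoord

section Tensors

variable {m : ℕ} {M : Type*} [TopologicalSpace M] [ChartedSpace (EuclideanSpace ℝ (Fin m)) M]
  [IsManifold (𝓡 m) ∞ M]

/-- Vectors with constant coordinates in the trivialization at `p` form a field smooth at `p`. -/
theorem smoothFieldAt_symmL (p : M) (v : EuclideanSpace ℝ (Fin m)) :
    SmoothFieldAt (fun q : M => (trivializationAt (EuclideanSpace ℝ (Fin m))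
      (TangentSpace (𝓡 m)) p).symmL ℝ q v) p :=
  ((trivializationAt (EuclideanSpace ℝ (Fin m)) (TangentSpace (𝓡 m)) p).contMDiffAt_symmL
    (IB := 𝓡 m) (n := ∞)
    (FiberBundle.mem_baseSet_trivializationAt' p)).clm_bundle_apply
    (E₁ := Bundle.Trivial M (EuclideanSpace ℝ (Fin m)))
    (contMDiffAt_totalSpace.2 ⟨contMDiffAt_id, contMDiffAt_const⟩) (v := fun _ => v)

/-- A field of endomorphisms is smooth if it maps fields smooth at a point to such fields: its
coordinate matrix has as columns its values on the fields of constant coordinates. -/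
theorem smoothEndo_of_forall {φ : Π p : M, TangentSpace (𝓡 m) p →L[ℝ] TangentSpace (𝓡 m) p}
    (h : ∀ p X, SmoothFieldAt X p → SmoothFieldAt (fun q => φ q (X q)) p) : SmoothEndo φ := by
  intro p
  refine (contMDiffAt_hom_bundle _).2 ⟨contMDiffAt_id, contMDiffAt_clm_of_apply fun v => ?_⟩
  have h₁ := (contMDiffAt_totalSpace.1 (h p _ (smoothFieldAt_symmL p v))).2
  refine h₁.congr_of_eventuallyEq ?_
  have A : ∀ᶠ q in nhds p, q ∈ (trivializationAt (EuclideanSpace ℝ (Fin m))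
      (TangentSpace (𝓡 m)) p).baseSet :=
    (trivializationAt (EuclideanSpace ℝ (Fin m)) (TangentSpace (𝓡 m)) p).open_baseSet.mem_nhds
      (FiberBundle.mem_baseSet_trivializationAt' p)
  filter_upwards [A] with q hq
  exact congrFun (Trivialization.coe_linearMapAt_of_mem (R := ℝ) _ hq) _

theorem smoothForm_of_forall {η : Π p : M, TangentSpace (𝓡 m) p →L[ℝ] ℝ}
    (h : ∀ p X, SmoothFieldAt X p → ContMDiffAt (𝓡 m) 𝓘(ℝ, ℝ) ∞ (fun q => η q (X q)) p) :
    SmoothForm η := by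
  intro p
  refine (contMDiffAt_hom_bundle (E₂ := Bundle.Trivial M ℝ) _).2
    ⟨contMDiffAt_id, contMDiffAt_clm_of_apply fun v => ?_⟩
  refine (h p _ (smoothFieldAt_symmL p v)).congr_of_eventuallyEq
    (Filter.Eventually.of_forall fun q => ?_)
  simp [ContinuousLinearMap.inCoordinates]

theorem SmoothFieldAt.sub {X Y : Π p : M, TangentSpace (𝓡 m) p} {p : M}
    (hX : SmoothFieldAt X p) (hY : SmoothFieldAt Y p) :
    SmoothFieldAt (fun q => X q - Y q) p :=
  ContMDiffAt.sub_section hX hY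

theorem SmoothFieldAt.neg {X : Π p : M, TangentSpace (𝓡 m) p} {p : M}
    (hX : SmoothFieldAt X p) : SmoothFieldAt (fun q => -X q) p :=
  ContMDiffAt.neg_section hX

theorem SmoothFieldAt.smul {f : M → ℝ} {X : Π p : M, TangentSpace (𝓡 m) p} {p : M}
    (hf : ContMDiffAt (𝓡 m) 𝓘(ℝ, ℝ) ∞ f p) (hX : SmoothFieldAt X p) :
    SmoothFieldAt (fun q => f q • X q) p :=
  ContMDiffAt.smul_section hf hX

end Tensors

/-! ### Vector fields along an immersion -/

section Along

variable {d : ℕ}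
  {Mbar : Type*} [TopologicalSpace Mbar] [ChartedSpace (EuclideanSpace ℝ (Fin (d + 1))) Mbar]
  [IsManifold (𝓡 (d + 1)) ∞ Mbar]
  {M : Type*} [TopologicalSpace M] [ChartedSpace (EuclideanSpace ℝ (Fin d)) M]

/-- Smoothness at a point of a vector field along a map `ι`. -/
def SmoothAlongAt (ι : M → Mbar) (W : Π p : M, TangentSpace (𝓡 (d + 1)) (ι p)) (p : M) : Prop :=
  ContMDiffAt (𝓡 d) (𝓡 (d + 1)).tangent ∞
    (fun q => (⟨ι q, W q⟩ : TangentBundle (𝓡 (d + 1)) Mbar)) p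

variable {ι : M → Mbar} {p : M}

theorem SmoothAlongAt.of_smoothField {Y : Π q : Mbar, TangentSpace (𝓡 (d + 1)) q}
    (hY : SmoothField Y) (hι : ContMDiff (𝓡 d) (𝓡 (d + 1)) ∞ ι) :
    SmoothAlongAt ι (fun q => Y (ι q)) p :=
  (hY (ι p)).comp p (hι p)

theorem SmoothAlongAt.endo
    {φ : Π q : Mbar, TangentSpace (𝓡 (d + 1)) q →L[ℝ] TangentSpace (𝓡 (d + 1)) q}
    (hφ : SmoothEndo φ) (hι : ContMDiff (𝓡 d) (𝓡 (d + 1)) ∞ ι)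
    {W : Π p : M, TangentSpace (𝓡 (d + 1)) (ι p)} (hW : SmoothAlongAt ι W p) :
    SmoothAlongAt ι (fun q => φ (ι q) (W q)) p :=
  ContMDiffAt.clm_bundle_apply (ϕ := fun q => φ (ι q)) ((hφ (ι p)).comp p (hι p)) hW

theorem SmoothAlongAt.form
    {η : Π q : Mbar, TangentSpace (𝓡 (d + 1)) q →L[ℝ] ℝ}
    (hη : SmoothForm η) (hι : ContMDiff (𝓡 d) (𝓡 (d + 1)) ∞ ι)
    {W : Π p : M, TangentSpace (𝓡 (d + 1)) (ι p)} (hW : SmoothAlongAt ι W p) :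
    ContMDiffAt (𝓡 d) 𝓘(ℝ, ℝ) ∞ (fun q => η (ι q) (W q)) p := by
  have h := ContMDiffAt.clm_bundle_apply (E₂ := Bundle.Trivial Mbar ℝ)
    (ϕ := fun q => η (ι q)) ((hη (ι p)).comp p (hι p)) hW
  exact (contMDiffAt_totalSpace.1 h).2

theorem SmoothAlongAt.bilin
    {g : Π q : Mbar, TangentSpace (𝓡 (d + 1)) q →L[ℝ] TangentSpace (𝓡 (d + 1)) q →L[ℝ] ℝ}
    (hg : SmoothBilin g) (hι : ContMDiff (𝓡 d) (𝓡 (d + 1)) ∞ ι)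
    {W Z : Π p : M, TangentSpace (𝓡 (d + 1)) (ι p)} (hW : SmoothAlongAt ι W p)
    (hZ : SmoothAlongAt ι Z p) :
    ContMDiffAt (𝓡 d) 𝓘(ℝ, ℝ) ∞ (fun q => g (ι q) (W q) (Z q)) p := by
  have h := ContMDiffAt.clm_bundle_apply₂ (E₃ := Bundle.Trivial Mbar ℝ)
    (ψ := fun q => g (ι q)) ((hg (ι p)).comp p (hι p)) hW hZ
  exact (contMDiffAt_totalSpace.1 h).2

variable [IsManifold (𝓡 d) ∞ M]

theorem SmoothFieldAt.dMap {X : Π p : M, TangentSpace (𝓡 d) p} (hX : SmoothFieldAt X p)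
    (hι : ContMDiff (𝓡 d) (𝓡 (d + 1)) ∞ ι) :
    SmoothAlongAt ι (fun q => dMap ι q (X q)) p :=
  (hι.contMDiff_tangentMap (m := ∞) (by simp)).contMDiffAt.comp p hX

/-- A vector field on `M` is smooth if its image under the differential of an immersion `ι` is
smooth along `ι`. In coordinates the differential is a smooth family of injective matrices `A q`;
with `B` a left inverse of `A p`, the field is recovered near `p` as `(B A q)⁻¹ B` applied to its
image. -/
theorem smoothFieldAt_of_dMap (hι : ContMDiff (𝓡 d) (𝓡 (d + 1)) ∞ ι)
    (hinj : ∀ p : M, Function.Injective (dMap (d := d) ι p))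
    {X : Π p : M, TangentSpace (𝓡 d) p} (h : SmoothAlongAt ι (fun q => dMap ι q (X q)) p) :
    SmoothFieldAt X p := by
  set e := trivializationAt (EuclideanSpace ℝ (Fin d)) (TangentSpace (𝓡 d)) p with he
  set e' := trivializationAt (EuclideanSpace ℝ (Fin (d + 1)))
    (TangentSpace (M := Mbar) (𝓡 (d + 1))) (ι p) with he'
  have hp : p ∈ e.baseSet := FiberBundle.mem_baseSet_trivializationAt' p
  have hp' : ι p ∈ e'.baseSet := FiberBundle.mem_baseSet_trivializationAt' (ι p)
  -- the differential of `ι` and the two vector fields, read in the trivializations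
  let A : M → EuclideanSpace ℝ (Fin d) →L[ℝ] EuclideanSpace ℝ (Fin (d + 1)) := fun q =>
    (e'.continuousLinearMapAt ℝ (ι q)).comp ((dMap ι q).comp (e.symmL ℝ q))
  have hA : ContMDiffAt (𝓡 d) 𝓘(ℝ, EuclideanSpace ℝ (Fin d) →L[ℝ] EuclideanSpace ℝ (Fin (d + 1)))
      ∞ A p := (hι p).mfderiv_const (m := ∞) (by simp)
  have hW := (contMDiffAt_totalSpace.1 h).2
  refine contMDiffAt_totalSpace.2 ⟨contMDiffAt_id, ?_⟩
  have hAinj : Function.Injective (A p) := by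
    intro v w hvw
    have h1 := congrArg (e'.symmL ℝ (ι p)) hvw
    simp only [A, ContinuousLinearMap.comp_apply,
      Trivialization.symmL_continuousLinearMapAt _ hp'] at h1
    have h2 := congrArg (e.continuousLinearMapAt ℝ p) (hinj p h1)
    simpa only [Trivialization.continuousLinearMapAt_symmL _ hp] using h2
  obtain ⟨B₀, hB₀⟩ := LinearMap.exists_leftInverse_of_injective (A p).toLinearMap
    (LinearMap.ker_eq_bot.2 hAinj)
  let B : EuclideanSpace ℝ (Fin (d + 1)) →L[ℝ] EuclideanSpace ℝ (Fin d) := B₀.toContinuousLinearMap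
  let C : M → EuclideanSpace ℝ (Fin d) →L[ℝ] EuclideanSpace ℝ (Fin d) := fun q => B.comp (A q)
  have hC : ContMDiffAt (𝓡 d) 𝓘(ℝ, EuclideanSpace ℝ (Fin d) →L[ℝ] EuclideanSpace ℝ (Fin d))
      ∞ C p := contMDiffAt_const.clm_comp hA
  have hCp : C p = ContinuousLinearMap.id ℝ _ := by
    ext1 v
    exact LinearMap.congr_fun hB₀ v
  have hinv : (C p).IsInvertible := hCp ▸ ⟨ContinuousLinearEquiv.refl ℝ _, rfl⟩
  have hCi := (hinv.contDiffAt_map_inverse (n := ∞)).contMDiffAt.comp p hC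
  have key := hCi.clm_apply ((B.contDiff (n := ∞)).contMDiff.contMDiffAt.comp p hW)
  refine key.congr_of_eventuallyEq ?_
  have n1 : ∀ᶠ q in nhds p, q ∈ e.baseSet := e.open_baseSet.mem_nhds hp
  have n2 : ∀ᶠ q in nhds p, ι q ∈ e'.baseSet :=
    (hι p).continuousAt (e'.open_baseSet.mem_nhds hp')
  have n3 : ∀ᶠ q in nhds p, (C q).IsInvertible :=
    hC.continuousAt (ContinuousLinearEquiv.nhds hinv.choose |> fun h => by
      rw [hinv.choose_spec] at h; exact h)
  filter_upwards [n1, n2, n3] with q h1 h2 h3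
  have hx : A q (e ⟨q, X q⟩).2 = (e' ⟨ι q, dMap ι q (X q)⟩).2 := by
    have h4 : e.symmL ℝ q (e ⟨q, X q⟩).2 = X q := by
      rw [← congrFun (Trivialization.coe_linearMapAt_of_mem (R := ℝ) e h1) (X q)]
      exact Trivialization.symmL_continuousLinearMapAt e h1 _
    simp only [A, ContinuousLinearMap.comp_apply]
    rw [h4]
    exact congrFun (Trivialization.coe_linearMapAt_of_mem (R := ℝ) e' h2) _
  obtain ⟨c, hc⟩ := h3
  change _ = (C q).inverse (B (e' ⟨ι q, dMap ι q (X q)⟩).2)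
  rw [← hx]
  change _ = (C q).inverse (C q (e ⟨q, X q⟩).2)
  rw [← hc]
  simp
  rfl

end Along

/-! ### Pointwise identities of a metric globally framed `f`-structure -/

section MetricGFF

variable {m r : ℕ} {M : Type*} [TopologicalSpace M] [ChartedSpace (EuclideanSpace ℝ (Fin m)) M]
  [IsManifold (𝓡 m) ∞ M]
  {φ : Π p : M, TangentSpace (𝓡 m) p →L[ℝ] TangentSpace (𝓡 m) p}
  {ξ : Fin r → Π p : M, TangentSpace (𝓡 m) p}
  {η : Fin r → Π p : M, TangentSpace (𝓡 m) p →L[ℝ] ℝ}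
  {g : Π p : M, TangentSpace (𝓡 m) p →L[ℝ] TangentSpace (𝓡 m) p →L[ℝ] ℝ}

theorem IsGloballyFramed.phi_xi (h : IsGloballyFramed φ ξ η) (α : Fin r) (p : M) :
    φ p (ξ α p) = 0 := by
  have : ξ α p ∈ (φ p).ker := by
    rw [h.ker_eq]
    exact Submodule.subset_span ⟨α, rfl⟩
  exact this

/-- Comparing `φ (φ² X)` with `φ² (φ X)` gives `∑ η^α(φX) ξ_α = 0`, whence `η^α ∘ φ = 0`. -/
theorem IsGloballyFramed.eta_phi (h : IsGloballyFramed φ ξ η) (α : Fin r) (p : M)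
    (X : TangentSpace (𝓡 m) p) : η α p (φ p X) = 0 := by
  have h1 := h.sq p (φ p X)
  rw [h.sq p X] at h1
  simp only [map_add, map_neg, map_sum, map_smul, h.phi_xi, smul_zero, Finset.sum_const_zero,
    add_zero] at h1
  have h2 := congrArg (η α p) (left_eq_add.1 h1)
  simpa [h.dual] using h2

theorem IsIndefiniteMetricGFF.g_symm (h : IsIndefiniteMetricGFF φ ξ η g) (p : M)
    (X Y : TangentSpace (𝓡 m) p) : g p X Y = g p Y X := by
  obtain ⟨ν, -, -, hg⟩ := h.metric
  exact hg.symm p X Y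

theorem IsIndefiniteMetricGFF.eq_zero_of_orth (h : IsIndefiniteMetricGFF φ ξ η g) {p : M}
    {X : TangentSpace (𝓡 m) p} (hX : ∀ Y, g p X Y = 0) : X = 0 := by
  obtain ⟨ν, -, -, hg⟩ := h.metric
  exact hg.nondegenerate p X hX

/-- The 1-form `η^α` is, up to the sign `ε_α`, metrically dual to `ξ_α`. -/
theorem IsIndefiniteMetricGFF.eta_eq_zero (h : IsIndefiniteMetricGFF φ ξ η g) {α : Fin r} {p : M}
    {X : TangentSpace (𝓡 m) p} (hX : g p X (ξ α p) = 0) : η α p X = 0 := by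
  obtain ⟨ε, hε, hc⟩ := h.compatible
  have h1 := hc p X (ξ α p)
  have hne : ε α ≠ 0 := by
    rcases hε α with h | h <;> simp [h.1]
  simpa [h.framed.phi_xi, hX, h.framed.dual, hne] using h1

theorem IsIndefiniteMetricGFF.g_phi_xi (h : IsIndefiniteMetricGFF φ ξ η g) (α : Fin r) (p : M)
    (X : TangentSpace (𝓡 m) p) : g p (φ p X) (ξ α p) = 0 := by
  obtain ⟨ε, hε, hc⟩ := h.compatible
  have h1 := hc p (φ p X) (ξ α p)
  simpa [h.framed.phi_xi, h.framed.eta_phi, eq_comm] using h1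

theorem IsIndefiniteMetricGFF.g_phi_phi (h : IsIndefiniteMetricGFF φ ξ η g) {p : M}
    {X : TangentSpace (𝓡 m) p} (hX : ∀ α, η α p X = 0) (Y : TangentSpace (𝓡 m) p) :
    g p (φ p X) (φ p Y) = g p X Y := by
  obtain ⟨ε, hε, hc⟩ := h.compatible
  simp [hc, hX]

/-- The tensor field `φ` is skew-adjoint. -/
theorem IsIndefiniteMetricGFF.g_phi_left (h : IsIndefiniteMetricGFF φ ξ η g) (p : M)
    (X Y : TangentSpace (𝓡 m) p) : g p (φ p X) Y = -g p X (φ p Y) := by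
  obtain ⟨ε, hε, hc⟩ := h.compatible
  have h1 := hc p X (φ p Y)
  rw [h.framed.sq p Y] at h1
  simp only [map_add, map_neg, map_sum, map_smul, h.g_phi_xi, h.framed.eta_phi, smul_zero,
    mul_zero, Finset.sum_const_zero, add_zero, sub_zero] at h1
  linarith

theorem IsIndefiniteMetricGFF.g_phi_self (h : IsIndefiniteMetricGFF φ ξ η g) (p : M)
    (X : TangentSpace (𝓡 m) p) : g p (φ p X) X = 0 := by
  have h1 := h.g_phi_left p X X
  rw [h.g_symm p X] at h1
  linarith

end MetricGFF

/-! ### Pointwise geometry of a characteristic lightlike hypersurface -/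

section Hypersurface

variable {d r : ℕ}
  {Mbar : Type*} [TopologicalSpace Mbar] [ChartedSpace (EuclideanSpace ℝ (Fin (d + 1))) Mbar]
  [IsManifold (𝓡 (d + 1)) ∞ Mbar]
  {M : Type*} [TopologicalSpace M] [ChartedSpace (EuclideanSpace ℝ (Fin d)) M]
  [IsManifold (𝓡 d) ∞ M]

/-- A characteristic lightlike hypersurface of an indefinite metric globally framed `f`-manifold,
together with a radical section `E`, a characteristic screen `S` and the transversal section `N`. -/
structure IsScreenedHypersurface
    (φ : Π q : Mbar, TangentSpace (𝓡 (d + 1)) q →L[ℝ] TangentSpace (𝓡 (d + 1)) q)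
    (ξ : Fin r → Π q : Mbar, TangentSpace (𝓡 (d + 1)) q)
    (η : Fin r → Π q : Mbar, TangentSpace (𝓡 (d + 1)) q →L[ℝ] ℝ)
    (g : Π q : Mbar,
      TangentSpace (𝓡 (d + 1)) q →L[ℝ] TangentSpace (𝓡 (d + 1)) q →L[ℝ] ℝ)
    (ι : M → Mbar) (E : Π p : M, TangentSpace (𝓡 d) p)
    (S : Π p : M, Submodule ℝ (TangentSpace (𝓡 d) p))
    (N : Π p : M, TangentSpace (𝓡 (d + 1)) (ι p)) : Prop where
  metricGFF : IsIndefiniteMetricGFF φ ξ η g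
  lightlike : IsLightlikeHypersurface g ι
  characteristic : IsCharacteristic ι ξ
  radical : IsRadicalSection g ι E
  screen : IsCharacteristicScreen g φ ι E S
  transversal : IsTransversalSection g ι E S N

namespace IsScreenedHypersurface

variable
  {φ : Π q : Mbar, TangentSpace (𝓡 (d + 1)) q →L[ℝ] TangentSpace (𝓡 (d + 1)) q}
  {ξ : Fin r → Π q : Mbar, TangentSpace (𝓡 (d + 1)) q}
  {η : Fin r → Π q : Mbar, TangentSpace (𝓡 (d + 1)) q →L[ℝ] ℝ}
  {g : Π q : Mbar,
    TangentSpace (𝓡 (d + 1)) q →L[ℝ] TangentSpace (𝓡 (d + 1)) q →L[ℝ] ℝ}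
  {ι : M → Mbar} {E : Π p : M, TangentSpace (𝓡 d) p}
  {S : Π p : M, Submodule ℝ (TangentSpace (𝓡 d) p)}
  {N : Π p : M, TangentSpace (𝓡 (d + 1)) (ι p)}
  {p : M}

theorem g_E (h : IsScreenedHypersurface φ ξ η g ι E S N) (X : TangentSpace (𝓡 d) p) :
    g (ι p) (dMap ι p X) (dMap ι p (E p)) = 0 := by
  rw [h.metricGFF.g_symm]
  exact h.radical.mem_rad p X

/-- The tangent hyperplane is the orthogonal complement of `E`. -/
theorem mem_range_of_g_E (h : IsScreenedHypersurface φ ξ η g ι E S N)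
    {w : TangentSpace (𝓡 (d + 1)) (ι p)} (hw : g (ι p) w (dMap ι p (E p)) = 0) :
    ∃ X, dMap ι p X = w := by
  let f : TangentSpace (𝓡 (d + 1)) (ι p) →ₗ[ℝ] ℝ := (g (ι p) (dMap ι p (E p))).toLinearMap
  have hf : f ≠ 0 := by
    intro h0
    have h1 := h.transversal.pair_E p
    rw [h.metricGFF.g_symm] at h1
    have h2 := LinearMap.congr_fun h0 (N p)
    simp only [f, ContinuousLinearMap.coe_coe, h1] at h2
    simp at h2
  have : FiniteDimensional ℝ (TangentSpace (𝓡 (d + 1)) (ι p)) :=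
    inferInstanceAs (FiniteDimensional ℝ (EuclideanSpace ℝ (Fin (d + 1))))
  have hle : (dMap (d := d) ι p).toLinearMap.range ≤ f.ker := by
    rintro _ ⟨X, rfl⟩
    exact h.radical.mem_rad p X
  have hfin : finrank ℝ (dMap (d := d) ι p).toLinearMap.range = finrank ℝ f.ker := by
    have h1 := LinearMap.finrank_range_of_inj (f := (dMap (d := d) ι p).toLinearMap)
      (h.lightlike.injective p)
    have h2 : finrank ℝ (TangentSpace (𝓡 d) p) = d := finrank_euclideanSpace_fin
    have h3 : finrank ℝ (TangentSpace (𝓡 (d + 1)) (ι p)) = d + 1 := finrank_euclideanSpace_fin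
    have h4 := Module.Dual.finrank_ker_add_one_of_ne_zero (f := f) hf
    omega
  have hmem : w ∈ f.ker := by
    change g (ι p) (dMap ι p (E p)) w = 0
    rw [h.metricGFF.g_symm, hw]
  rw [← Submodule.eq_of_le_of_finrank_eq hle hfin] at hmem
  exact hmem

/-- The tangent hyperplane and the transversal vector `N` together span the ambient tangent space,
so nondegeneracy may be tested on them. -/
theorem eq_zero_of_orth_tangent_of_orth_N (h : IsScreenedHypersurface φ ξ η g ι E S N)
    {w : TangentSpace (𝓡 (d + 1)) (ι p)} (hw : ∀ X, g (ι p) w (dMap ι p X) = 0)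
    (hN : g (ι p) w (N p) = 0) : w = 0 := by
  refine h.metricGFF.eq_zero_of_orth fun Y => ?_
  obtain ⟨X, hX⟩ := h.mem_range_of_g_E (p := p)
    (w := Y - g (ι p) Y (dMap ι p (E p)) • N p) (by simp [h.transversal.pair_E])
  have h1 := hw X
  rw [hX] at h1
  simpa [hN] using h1

/-- The radical is a line: `v - g(N, v) E` is orthogonal to the hypersurface and to `N` whenever
`v` is radical. -/
theorem rad_eq_span (h : IsScreenedHypersurface φ ξ η g ι E S N) (p : M) :
    rad g ι p = Submodule.span ℝ {E p} := by
  apply le_antisymm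
  · intro v hv
    have h0 : dMap ι p v - g (ι p) (N p) (dMap ι p v) • dMap ι p (E p) = 0 := by
      refine h.eq_zero_of_orth_tangent_of_orth_N (fun X => ?_) ?_
      · have h1 : g (ι p) (dMap ι p v) (dMap ι p X) = 0 := hv X
        have h2 : g (ι p) (dMap ι p (E p)) (dMap ι p X) = 0 := h.radical.mem_rad p X
        simp [h1, h2]
      · have h1 := h.transversal.pair_E p
        rw [h.metricGFF.g_symm] at h1
        simp [h1, h.metricGFF.g_symm _ (N p)]
    rw [sub_eq_zero, ← map_smul] at h0
    rw [h.lightlike.injective p h0]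
    exact Submodule.smul_mem _ _ (Submodule.mem_span_singleton_self _)
  · rw [Submodule.span_singleton_le_iff_mem]
    exact h.radical.mem_rad p

theorem xi_mem_screen (h : IsScreenedHypersurface φ ξ η g ι E S N) (α : Fin r) (p : M) :
    ∃ X ∈ S p, dMap ι p X = ξ α (ι p) :=
  h.screen.ker_le p (h.metricGFF.framed.phi_xi α (ι p))

theorem phi_E_mem_screen (h : IsScreenedHypersurface φ ξ η g ι E S N) (p : M) :
    ∃ X ∈ S p, dMap ι p X = φ (ι p) (dMap ι p (E p)) :=
  h.screen.phi_mem p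

theorem eta_E (h : IsScreenedHypersurface φ ξ η g ι E S N) (α : Fin r) (p : M) :
    η α (ι p) (dMap ι p (E p)) = 0 := by
  apply h.metricGFF.eta_eq_zero
  obtain ⟨X, -, hX⟩ := h.xi_mem_screen α p
  rw [← hX, h.metricGFF.g_symm, h.g_E]

theorem eta_N (h : IsScreenedHypersurface φ ξ η g ι E S N) (α : Fin r) (p : M) :
    η α (ι p) (N p) = 0 := by
  apply h.metricGFF.eta_eq_zero
  obtain ⟨X, hS, hX⟩ := h.xi_mem_screen α p
  rw [← hX, h.transversal.orth p X hS]

/-- A tangent vector orthogonal to `N` lies in the screen. -/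
theorem mem_screen (h : IsScreenedHypersurface φ ξ η g ι E S N) {X : TangentSpace (𝓡 d) p}
    (hX : g (ι p) (N p) (dMap ι p X) = 0) : X ∈ S p := by
  obtain ⟨a, ha, s, hs, rfl⟩ := Submodule.mem_sup.1
    ((h.screen.isCompl p).sup_eq_top.ge (Submodule.mem_top (x := X)))
  rw [h.rad_eq_span p] at ha
  obtain ⟨c, rfl⟩ := Submodule.mem_span_singleton.1 ha
  have h1 := h.transversal.orth p s hs
  have hc : c = 0 := by simpa [h1, h.transversal.pair_E] using hX
  simpa [hc] using hs

/-- The vector `φN` is tangent because `g(φN, E) = -g(N, φE) = 0`, and lies in the screen because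
`g(φN, N) = 0`. -/
theorem phi_N_mem_screen (h : IsScreenedHypersurface φ ξ η g ι E S N) (p : M) :
    ∃ X ∈ S p, dMap ι p X = φ (ι p) (N p) := by
  obtain ⟨X, hX⟩ := h.mem_range_of_g_E (p := p) (w := φ (ι p) (N p)) (by
    obtain ⟨Y, hY, hE⟩ := h.phi_E_mem_screen p
    rw [h.metricGFF.g_phi_left, ← hE, h.transversal.orth p Y hY, neg_zero])
  refine ⟨X, h.mem_screen ?_, hX⟩
  rw [hX, h.metricGFF.g_symm, h.metricGFF.g_phi_self]

theorem g_phi_N_phi_E (h : IsScreenedHypersurface φ ξ η g ι E S N) (p : M) :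
    g (ι p) (φ (ι p) (N p)) (φ (ι p) (dMap ι p (E p))) = 1 := by
  rw [h.metricGFF.g_phi_phi (h.eta_N · p), h.transversal.pair_E]

theorem phi_phi_E (h : IsScreenedHypersurface φ ξ η g ι E S N) (p : M) :
    φ (ι p) (φ (ι p) (dMap ι p (E p))) = -dMap ι p (E p) := by
  simp [h.metricGFF.framed.sq, h.eta_E]

/-- `φ(Rad(TM))` is the line spanned by any `V` with `dι V = -φE`. -/
theorem phiRad_eq_span (h : IsScreenedHypersurface φ ξ η g ι E S N) {V : TangentSpace (𝓡 d) p}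
    (hV : dMap ι p V = -φ (ι p) (dMap ι p (E p))) : phiRad g φ ι p = Submodule.span ℝ {V} := by
  rw [phiRad, h.rad_eq_span, Submodule.map_span, Submodule.map_span]
  ext X
  simp only [Set.image_singleton, ContinuousLinearMap.coe_coe, Submodule.mem_comap,
    Submodule.mem_span_singleton]
  constructor
  · rintro ⟨c, hc⟩
    refine ⟨-c, h.lightlike.injective p ?_⟩
    rw [map_smul, hV, ← hc, neg_smul_neg]
  · rintro ⟨c, rfl⟩
    exact ⟨-c, by rw [map_smul, hV, smul_neg, neg_smul]⟩

/-- `φ(ltr(M))` is the line spanned by any `U` with `dι U = -φN`. -/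
theorem phiLtr_eq_span (h : IsScreenedHypersurface φ ξ η g ι E S N) {U : TangentSpace (𝓡 d) p}
    (hU : dMap ι p U = -φ (ι p) (N p)) : phiLtr φ ι N p = Submodule.span ℝ {U} := by
  rw [phiLtr, Submodule.map_span]
  ext X
  simp only [Set.image_singleton, ContinuousLinearMap.coe_coe, Submodule.mem_comap,
    Submodule.mem_span_singleton]
  constructor
  · rintro ⟨c, hc⟩
    refine ⟨-c, h.lightlike.injective p ?_⟩
    rw [map_smul, hU, ← hc, neg_smul_neg]
  · rintro ⟨c, rfl⟩
    exact ⟨-c, by rw [map_smul, hU, smul_neg, neg_smul]⟩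

/-- The distribution `D` is the kernel of `u = g(·, V)`. -/
theorem mem_distD_iff (h : IsScreenedHypersurface φ ξ η g ι E S N) {U V : TangentSpace (𝓡 d) p}
    (hU : dMap ι p U = -φ (ι p) (N p)) (hV : dMap ι p V = -φ (ι p) (dMap ι p (E p)))
    {X : TangentSpace (𝓡 d) p} :
    X ∈ distD g φ ι S N p ↔ inducedMetric g ι p X V = 0 := by
  have hVV : inducedMetric g ι p V V = 0 := by
    simp only [inducedMetric, hV, map_neg, neg_apply, neg_neg]
    rw [h.metricGFF.g_phi_phi (h.eta_E · p), h.g_E]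
  have hVU : inducedMetric g ι p V U = 1 := by
    rw [inducedMetric, h.metricGFF.g_symm, hU, hV]
    simpa using h.g_phi_N_phi_E p
  have hEV : ∀ Y, inducedMetric g ι p (E p) Y = 0 := h.radical.mem_rad p
  have hrad := h.phiRad_eq_span hV
  have hltr := h.phiLtr_eq_span hU
  have hVS : V ∈ S p := h.mem_screen (by
    obtain ⟨Y, hY, hE⟩ := h.phi_E_mem_screen p
    rw [hV, ← hE, map_neg, h.transversal.orth p Y hY, neg_zero])
  constructor
  · intro hX
    obtain ⟨y, hy, e, he, rfl⟩ := Submodule.mem_sup.1 hX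
    obtain ⟨a, ha, v, hv, rfl⟩ := Submodule.mem_sup.1 hy
    rw [h.rad_eq_span] at he
    rw [hrad] at hv
    obtain ⟨c, rfl⟩ := Submodule.mem_span_singleton.1 he
    obtain ⟨b, rfl⟩ := Submodule.mem_span_singleton.1 hv
    have h1 := ha.2 V (Submodule.mem_sup_left (hrad ▸ Submodule.mem_span_singleton_self V))
    have h2 := hEV V
    simp only [inducedMetric] at h1 h2 hVV ⊢
    simp [h1, h2, hVV]
  · intro hX
    obtain ⟨e, he, s, hs, rfl⟩ := Submodule.mem_sup.1
      ((h.screen.isCompl p).sup_eq_top.ge (Submodule.mem_top (x := X)))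
    have hsV : inducedMetric g ι p s V = 0 := by
      have h1 : inducedMetric g ι p e V = 0 := he V
      simp only [inducedMetric] at hX h1 ⊢
      simpa [h1] using hX
    -- subtracting the multiple of `V` prescribed by `g(V, U) = 1` leaves a vector of `D₀`
    have h0 : s - inducedMetric g ι p s U • V ∈ distD₀ g φ ι S N p := by
      refine ⟨(S p).sub_mem hs ((S p).smul_mem _ hVS), fun w hw => ?_⟩
      rw [hrad, hltr] at hw
      obtain ⟨v, hv, u, hu, rfl⟩ := Submodule.mem_sup.1 hw
      obtain ⟨b, rfl⟩ := Submodule.mem_span_singleton.1 hv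
      obtain ⟨c, rfl⟩ := Submodule.mem_span_singleton.1 hu
      simp only [inducedMetric] at hsV hVV hVU ⊢
      simp [hsV, hVV, hVU, mul_comm c]
    have hV' : inducedMetric g ι p s U • V ∈ phiRad g φ ι p :=
      hrad ▸ Submodule.smul_mem _ _ (Submodule.mem_span_singleton_self V)
    have h3 := Submodule.add_mem_sup (Submodule.add_mem_sup h0 hV') he
    rw [sub_add_cancel, add_comm] at h3
    exact h3

theorem isCompl_distD (h : IsScreenedHypersurface φ ξ η g ι E S N) {U V : TangentSpace (𝓡 d) p}
    (hU : dMap ι p U = -φ (ι p) (N p)) (hV : dMap ι p V = -φ (ι p) (dMap ι p (E p))) :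
    IsCompl (distD g φ ι S N p) (phiLtr φ ι N p) := by
  have hUV : inducedMetric g ι p U V = 1 := by
    rw [inducedMetric, hU, hV]
    simpa using h.g_phi_N_phi_E p
  rw [h.phiLtr_eq_span hU]
  constructor
  · rw [Submodule.disjoint_def]
    intro X hX hX'
    obtain ⟨c, rfl⟩ := Submodule.mem_span_singleton.1 hX'
    rw [h.mem_distD_iff hU hV] at hX
    simp only [inducedMetric] at hX hUV
    have hc : c = 0 := by simpa [hUV] using hX
    simp [hc]
  · rw [codisjoint_iff, eq_top_iff]
    intro X _
    have h1 : X - inducedMetric g ι p X V • U ∈ distD g φ ι S N p := by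
      rw [h.mem_distD_iff hU hV]
      simp only [inducedMetric] at hUV ⊢
      simp [hUV]
    have h2 := Submodule.add_mem_sup h1
      (Submodule.smul_mem _ (inducedMetric g ι p X V) (Submodule.mem_span_singleton_self U))
    rwa [sub_add_cancel] at h2

theorem projection_distD (h : IsScreenedHypersurface φ ξ η g ι E S N)
    {U V : TangentSpace (𝓡 d) p}
    (hU : dMap ι p U = -φ (ι p) (N p)) (hV : dMap ι p V = -φ (ι p) (dMap ι p (E p)))
    (hD : IsCompl (distD g φ ι S N p) (phiLtr φ ι N p)) (X : TangentSpace (𝓡 d) p) :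
    Submodule.projection _ _ hD X = X - inducedMetric g ι p X V • U := by
  have hUV : inducedMetric g ι p U V = 1 := by
    rw [inducedMetric, hU, hV]
    simpa using h.g_phi_N_phi_E p
  have h1 : X - inducedMetric g ι p X V • U ∈ distD g φ ι S N p := by
    rw [h.mem_distD_iff hU hV]
    simp only [inducedMetric] at hUV ⊢
    simp [hUV]
  have h2 : inducedMetric g ι p X V • U ∈ phiLtr φ ι N p := by
    rw [h.phiLtr_eq_span hU]
    exact Submodule.smul_mem _ _ (Submodule.mem_span_singleton_self U)
  have h3 := map_add (Submodule.projection _ _ hD) (X - inducedMetric g ι p X V • U)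
    (inducedMetric g ι p X V • U)
  rwa [sub_add_cancel, Submodule.projection_apply_of_mem_left hD h1,
    Submodule.projection_apply_of_mem_right hD h2, add_zero] at h3

end IsScreenedHypersurface

end Hypersurface

/-! ### Recognizing a globally framed `f`-structure -/

section Rank

variable {m r : ℕ} {M : Type*} [TopologicalSpace M] [ChartedSpace (EuclideanSpace ℝ (Fin m)) M]
  [IsManifold (𝓡 m) ∞ M]
  {φ : Π p : M, TangentSpace (𝓡 m) p →L[ℝ] TangentSpace (𝓡 m) p}
  {ξ : Fin r → Π p : M, TangentSpace (𝓡 m) p}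
  {η : Fin r → Π p : M, TangentSpace (𝓡 m) p →L[ℝ] ℝ}

/-- For a nowhere vanishing `φ`, the remaining pointwise requirements on a globally framed
`f`-structure follow from the two algebraic identities and `φ ξ_α = 0`: the kernel is then framed
by the `ξ_α`, hence of dimension `r`, and the rank is the constant `m - r`. -/
theorem isGloballyFramed_of_sq_of_dual (hφ : SmoothEndo φ) (hξ : ∀ α, SmoothField (ξ α))
    (hη : ∀ α, SmoothForm (η α)) (hne : ∀ p, φ p ≠ 0) (hzero : ∀ p α, φ p (ξ α p) = 0)
    (hsq : ∀ p X, φ p (φ p X) = -X + ∑ α, η α p X • ξ α p)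
    (hdual : ∀ p α β, η α p (ξ β p) = if α = β then 1 else 0) : IsGloballyFramed φ ξ η := by
  have hker : ∀ p, (φ p).ker = Submodule.span ℝ (Set.range fun α => ξ α p) := by
    intro p
    apply le_antisymm
    · intro X hX
      have hX' : φ p X = 0 := hX
      have h1 := hsq p X
      rw [hX', map_zero] at h1
      rw [neg_add_eq_zero.1 h1.symm]
      exact Submodule.sum_mem _ fun α _ =>
        Submodule.smul_mem _ _ (Submodule.subset_span ⟨α, rfl⟩)
    · rw [Submodule.span_le]
      rintro _ ⟨α, rfl⟩
      exact hzero p α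
  have hfin : ∀ p : M, FiniteDimensional ℝ (TangentSpace (𝓡 m) p) := fun p =>
    inferInstanceAs (FiniteDimensional ℝ (EuclideanSpace ℝ (Fin m)))
  have hrank : ∀ p, finrank ℝ (φ p).range + r = m := by
    intro p
    have hli : LinearIndependent ℝ fun α => ξ α p := by
      rw [Fintype.linearIndependent_iff]
      intro c hc α
      have h1 := congrArg (η α p) hc
      simpa [hdual] using h1
    have h1 := finrank_span_eq_card hli
    rw [← hker p, Fintype.card_fin] at h1
    have h2 := (φ p).toLinearMap.finrank_range_add_finrank_ker
    have h3 : finrank ℝ (TangentSpace (𝓡 m) p) = m := finrank_euclideanSpace_fin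
    rw [h3] at h2
    rw [← h1]
    exact h2
  refine ⟨hφ, hξ, hη, ?_, hker, hsq, hdual⟩
  cases isEmpty_or_nonempty M with
  -- over the empty manifold any positive number serves as the rank
  | inl hM => exact ⟨1, one_pos, fun p => (hM.false p).elim⟩
  | inr hM =>
    obtain ⟨p⟩ := hM
    refine ⟨finrank ℝ (φ p).range, ?_, fun q => ?_⟩
    · rw [Nat.pos_iff_ne_zero]
      intro h0
      apply hne p
      have h1 := Submodule.finrank_eq_zero.1 h0
      ext1 X
      have h2 : φ p X ∈ (φ p).range := ⟨X, rfl⟩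
      rw [h1] at h2
      exact h2
    · have h1 := hrank p
      have h2 := hrank q
      omega

end Rank

theorem exists_leftInverse_dMap {d : ℕ}
    {Mbar : Type*} [TopologicalSpace Mbar] [ChartedSpace (EuclideanSpace ℝ (Fin (d + 1))) Mbar]
    {M : Type*} [TopologicalSpace M] [ChartedSpace (EuclideanSpace ℝ (Fin d)) M]
    {ι : M → Mbar} (p : M) (h : Function.Injective (dMap (d := d) ι p)) :
    ∃ L : TangentSpace (𝓡 (d + 1)) (ι p) →L[ℝ] TangentSpace (𝓡 d) p,
      ∀ X, L (dMap ι p X) = X := by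
  obtain ⟨L, hL⟩ := LinearMap.exists_leftInverse_of_injective (dMap (d := d) ι p).toLinearMap
    (LinearMap.ker_eq_bot.2 h)
  have : FiniteDimensional ℝ (TangentSpace (𝓡 (d + 1)) (ι p)) :=
    inferInstanceAs (FiniteDimensional ℝ (EuclideanSpace ℝ (Fin (d + 1))))
  have : T2Space (TangentSpace (𝓡 (d + 1)) (ι p)) :=
    inferInstanceAs (T2Space (EuclideanSpace ℝ (Fin (d + 1))))
  exact ⟨L.toContinuousLinearMap, fun X => LinearMap.congr_fun hL X⟩

end LightlikeGFF

open LightlikeGFF in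
theorem mainTheorem1 {d r : ℕ}
    {Mbar : Type*} [TopologicalSpace Mbar]
    [ChartedSpace (EuclideanSpace ℝ (Fin (d + 1))) Mbar] [IsManifold (𝓡 (d + 1)) ∞ Mbar]
    {M : Type*} [TopologicalSpace M]
    [ChartedSpace (EuclideanSpace ℝ (Fin d)) M] [IsManifold (𝓡 d) ∞ M]
    -- the indefinite S-manifold
    (φbar : Π q : Mbar, TangentSpace (𝓡 (d + 1)) q →L[ℝ] TangentSpace (𝓡 (d + 1)) q)
    (ξbar : Fin r → Π q : Mbar, TangentSpace (𝓡 (d + 1)) q)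
    (ηbar : Fin r → Π q : Mbar, TangentSpace (𝓡 (d + 1)) q →L[ℝ] ℝ)
    (gbar : Π q : Mbar,
      TangentSpace (𝓡 (d + 1)) q →L[ℝ] TangentSpace (𝓡 (d + 1)) q →L[ℝ] ℝ)
    (hbar : IsIndefiniteSManifold φbar ξbar ηbar gbar)
    -- the characteristic lightlike hypersurface, with `E`, `S(TM)` and `N`
    (ι : M → Mbar) (hι : IsLightlikeHypersurface gbar ι) (hchar : IsCharacteristic ι ξbar)
    (E : Π p : M, TangentSpace (𝓡 d) p) (hE : IsRadicalSection gbar ι E)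
    (S : Π p : M, Submodule ℝ (TangentSpace (𝓡 d) p))
    (hS : IsCharacteristicScreen gbar φbar ι E S)
    (N : Π p : M, TangentSpace (𝓡 (d + 1)) (ι p))
    (hN : IsTransversalSection gbar ι E S N) :
    -- `TM = D ⊕ φbar(ltr(M))`, so that the projection of `TM` onto `D` makes sense
    ∃ hD : ∀ p, IsCompl (distD gbar φbar ι S N p) (phiLtr φbar ι N p),
    ∃ (φ : Π p : M, TangentSpace (𝓡 d) p →L[ℝ] TangentSpace (𝓡 d) p)
      (ξ : Fin r → Π p : M, TangentSpace (𝓡 d) p)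
      (U V : Π p : M, TangentSpace (𝓡 d) p)
      (η : Fin r → Π p : M, TangentSpace (𝓡 d) p →L[ℝ] ℝ)
      (u : Π p : M, TangentSpace (𝓡 d) p →L[ℝ] ℝ),
      (∀ p X, dMap ι p (φ p X) = φbar (ι p) (dMap ι p (Submodule.projection _ _ (hD p) X))) ∧
      (∀ α p, dMap ι p (ξ α p) = ξbar α (ι p)) ∧
      (∀ p, dMap ι p (U p) = -φbar (ι p) (N p)) ∧
      (∀ p, dMap ι p (V p) = -φbar (ι p) (dMap ι p (E p))) ∧
      (∀ α p X, η α p X = ηbar α (ι p) (dMap ι p X)) ∧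
      (∀ p X, u p X = inducedMetric gbar ι p X (V p)) ∧
      IsGloballyFramed φ
        (Fin.snoc (α := fun _ => Π p : M, TangentSpace (𝓡 d) p) ξ U)
        (Fin.snoc (α := fun _ => Π p : M, TangentSpace (𝓡 d) p →L[ℝ] ℝ) η u) := by
  have h : IsScreenedHypersurface φbar ξbar ηbar gbar ι E S N :=
    ⟨hbar.metricGFF, hι, hchar, hE, hS, hN⟩
  have hgff := h.metricGFF
  have hfr := hgff.framed
  obtain ⟨ν, -, -, hmet⟩ := hgff.metric
  choose ξ _ hξ using h.xi_mem_screen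
  choose U' _ hU' using h.phi_N_mem_screen
  choose V' _ hV' using h.phi_E_mem_screen
  choose L hL using fun p => exists_leftInverse_dMap p (hι.injective p)
  -- the fields `U'`, `V'` lift `φbar N`, `φbar E`; the fields of the theorem carry the opposite sign
  let U : Π p : M, TangentSpace (𝓡 d) p := fun p => -U' p
  let V : Π p : M, TangentSpace (𝓡 d) p := fun p => -V' p
  have hU : ∀ p, dMap ι p (U p) = -φbar (ι p) (N p) := fun p => by simp [U, hU']
  have hV : ∀ p, dMap ι p (V p) = -φbar (ι p) (dMap ι p (E p)) := fun p => by simp [V, hV']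
  let η : Fin r → Π p : M, TangentSpace (𝓡 d) p →L[ℝ] ℝ := fun α p =>
    (ηbar α (ι p)).comp (dMap ι p)
  let u : Π p : M, TangentSpace (𝓡 d) p →L[ℝ] ℝ := fun p =>
    (gbar (ι p) (dMap ι p (V p))).comp (dMap ι p)
  have hη : ∀ α p X, η α p X = ηbar α (ι p) (dMap ι p X) := fun α p X => rfl
  have hu : ∀ p X, u p X = inducedMetric gbar ι p X (V p) := fun p X =>
    hgff.g_symm (ι p) _ _
  have hu' : ∀ p X, u p X = -gbar (ι p) (dMap ι p X) (φbar (ι p) (dMap ι p (E p))) := by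
    intro p X
    rw [hu, inducedMetric, hV, map_neg]
  -- `X - u(X) U` is the projection of `X` onto `D`, and `L p` inverts the differential of `ι`
  let φ : Π p : M, TangentSpace (𝓡 d) p →L[ℝ] TangentSpace (𝓡 d) p := fun p =>
    (L p).comp ((φbar (ι p)).comp ((dMap ι p).comp
      (ContinuousLinearMap.id ℝ _ - (u p).smulRight (U p))))
  have huU : ∀ p, u p (U p) = 1 := by
    intro p
    rw [hu', hU]
    simpa using h.g_phi_N_phi_E p
  -- the image `φbar (X - u(X) U)` is orthogonal to `E`, hence tangent to the hypersurface
  have hφ : ∀ p X, dMap ι p (φ p X) = φbar (ι p) (dMap ι p (X - u p X • U p)) := by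
    intro p X
    obtain ⟨Y, hY⟩ := h.mem_range_of_g_E (p := p)
      (w := φbar (ι p) (dMap ι p (X - u p X • U p))) (by
        rw [hgff.g_phi_left, ← hu']
        simp [huU])
    change dMap ι p (L p (φbar (ι p) (dMap ι p (X - u p X • U p)))) = _
    rw [← hY, hL]
  have hD : ∀ p, IsCompl (distD gbar φbar ι S N p) (phiLtr φbar ι N p) := fun p =>
    h.isCompl_distD (hU p) (hV p)
  have huξ : ∀ p α, u p (ξ α p) = 0 := by
    intro p α
    rw [hu', ← hgff.g_phi_left, hξ, hfr.phi_xi]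
    simp
  have hηU : ∀ α p, η α p (U p) = 0 := by
    intro α p
    rw [hη, hU, map_neg, hfr.eta_phi, neg_zero]
  -- `φ` takes values in `D`, the kernel of `u`
  have huφ : ∀ p X, u p (φ p X) = 0 := by
    intro p X
    have h1 : gbar (ι p) (φbar (ι p) (dMap ι p (E p)))
        (φbar (ι p) (dMap ι p (X - u p X • U p))) = 0 := by
      rw [hgff.g_phi_phi (h.eta_E · p), hgff.g_symm, h.g_E]
    rw [hu', hφ, hgff.g_symm, h1, neg_zero]
  have hsξ : ∀ α, SmoothField (ξ α) := fun α p =>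
    smoothFieldAt_of_dMap hι.smooth hι.injective (by
      simp only [hξ]
      exact SmoothAlongAt.of_smoothField (hfr.smooth_xi α) hι.smooth)
  have hsU : SmoothField U := fun p => SmoothFieldAt.neg
    (smoothFieldAt_of_dMap hι.smooth hι.injective (by
      simp only [hU']
      exact SmoothAlongAt.endo hfr.smooth_phi hι.smooth (hN.smooth p)))
  have hsu : ∀ p X, SmoothFieldAt X p → ContMDiffAt (𝓡 d) 𝓘(ℝ, ℝ) ∞ (fun q => u q (X q)) p := by
    intro p X hX
    simp only [hu']
    exact (SmoothAlongAt.bilin hmet.smooth hι.smooth (hX.dMap hι.smooth)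
      (SmoothAlongAt.endo hfr.smooth_phi hι.smooth ((hE.smooth p).dMap hι.smooth))).neg
  have hsη : ∀ α, SmoothForm (η α) := fun α => smoothForm_of_forall fun p X hX =>
    SmoothAlongAt.form (hfr.smooth_eta α) hι.smooth (hX.dMap hι.smooth)
  have hsφ : SmoothEndo φ := smoothEndo_of_forall fun p X hX =>
    smoothFieldAt_of_dMap hι.smooth hι.injective (by
      simp only [hφ]
      exact SmoothAlongAt.endo hfr.smooth_phi hι.smooth
        ((hX.sub ((hsU p).smul (hsu p X hX))).dMap hι.smooth))
  refine ⟨hD, φ, ξ, U, V, η, u, ?_, fun α p => hξ α p, hU, hV, hη, hu, ?_⟩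
  · intro p X
    rw [hφ, h.projection_distD (hU p) (hV p) (hD p), hu]
  refine isGloballyFramed_of_sq_of_dual hsφ ?_ ?_ ?_ ?_ ?_ ?_
  · intro α
    refine Fin.lastCases ?_ (fun β => ?_) α
    · simpa using hsU
    · simpa using hsξ β
  · intro α
    refine Fin.lastCases ?_ (fun β => ?_) α
    · simpa using smoothForm_of_forall hsu
    · simpa using hsη β
  · -- `φ` maps `V` to `E`
    intro p h0
    have h1 : u p (V p) = 0 := by
      rw [hu', hV]
      simp [hgff.g_phi_phi (h.eta_E · p), h.g_E]
    have h2 := (hφ p (V p)).symm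
    rw [h1, zero_smul, sub_zero, hV, map_neg, h.phi_phi_E, neg_neg, h0] at h2
    exact hE.ne_zero p (hι.injective p h2)
  · intro p α
    apply hι.injective p
    rw [hφ]
    refine Fin.lastCases ?_ (fun β => ?_) α
    · simp [huU]
    · simp [huξ, hξ, hfr.phi_xi]
  · intro p X
    apply hι.injective p
    have h1 : ∑ α, ηbar α (ι p) (dMap ι p (X - u p X • U p)) • ξbar α (ι p) =
        dMap ι p (∑ α, η α p X • ξ α p) := by
      rw [map_sum]
      refine Finset.sum_congr rfl fun α _ => ?_
      rw [map_smul, hξ, ← hη, map_sub, map_smul, hηU, smul_zero, sub_zero]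
    rw [hφ, huφ, zero_smul, sub_zero, hφ, hfr.sq, h1, Fin.sum_univ_castSucc]
    simp only [Fin.snoc_castSucc, Fin.snoc_last]
    rw [← map_neg, ← map_add]
    congr 1
    abel
  · intro p α β
    refine Fin.lastCases ?_ (fun α => ?_) α <;> refine Fin.lastCases ?_ (fun β => ?_) β
    · simp [huU]
    · simp [huξ, (Fin.castSucc_lt_last β).ne']
    · simp [hηU, (Fin.castSucc_lt_last α).ne]
    · simp [hη, hξ, hfr.dual]
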